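/- **Model.** The network is a simple graph $G$ on $n\ge 2$ nodes with distinct identifiers from a space of size at most $n^{a}$, $a$ a constant. In the synchronous BCONGEST model, in each round every node may broadcast one $O(\log n)$-bit message, the same to all its neighbours, and then updates its state from the messages it receives; local computation is free. A node initially knows $n$, its own identifier, its own input, and a shared random string. A *(partial) BFS algorithm* $\mathcal A$ with source $s$ and depth limit $h\in\mathbb N\cup\{\infty\}$ is the standard one: $s$ broadcasts in the first round (if $h>0$); every other node, in the round in which it first receives an exploration message, records its distance from $s$ (the number of rounds so far) and, as its parent, the sender with smallest identifier among those it hears from in that round, and if its distance is less than $h$ it broadcasts in the next round. It broadcasts at no other time. The *running time* of an algorithm is the least number of rounds after which no node broadcasts any more and all outputs are final. For a collection $\mathcal A_1,\dots,\mathcal A_\ell$, $\mathsf{dilation}$ is the maximum running time of any $\mathcal A_j$ executed in isolation. **Theorem.** There is a constant $k$ such that for every constant $c$ there is a constant $C>0$ with the following property. Let $\ell\le n$ and let $\mathcal A_1,\dots,\mathcal A_\ell$ be (partial) BFS algorithms with distinct sources and depth limits $h_1,\dots,h_\ell$. The depth limits are known to all nodes, and each node knows of which of the $\mathcal A_j$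 it is the source. Let the shared random string consist of independent delays $d_1,\dots,d_\ell$, each uniform on the integers $\{1,\dots,\ell\}$. Then there are an integer $1\le L\le C\log n$ and a BCONGEST algorithm $\mathcal S$, both depending only on $n$, $\ell$, the size of the identifier space, $h_1,\dots,h_\ell$ and $c$ (not on $G$, the identifiers or the sources), whose messages have $O(\log n)$ bits (with a constant depending only on $c$ and $a$) and are each a message of one $\mathcal A_j$ tagged with $j$, such that for every such network and all such sources, with probability at least $1-n^{-c}$, all of the following hold. * $\mathcal S$ executes every $\mathcal A_j$ as is, started after the delay $d_j$, in phases of $L$ rounds: numbering rounds and phases from $0$, for all $j$, $r$ and $v$, what $v$ broadcasts in round $r$ of $\mathcal A_j$ in isolation, it broadcasts in $\mathcal S$ exactly once during phase $d_j+r$, and nothing else is broadcast. * (i) After at most $C\,(\ell+\mathsf{dilation})\,(\log n)^{k}=\tilde O(\ell+\mathsf{dilation})$ rounds of $\mathcal S$ all the $\mathcal A_j$ are complete: no node broadcasts any more, and every node holds, for every $j$, the output that it has in $\mathcal A_j$ executed in isolation. * (ii) In every round, and even in every phase, every node receives messages of at most $C\log n$ distinct algorithms $\mathcal A_j$. -/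

import Mathlib

open MeasureTheory ProbabilityTheory

/-! ### The BCONGEST model -/

/-- A distributed algorithm in the synchronous broadcast model. All nodes run the same local rules.
A node initially knows only the shared random string (`Seed`) and its own local input (`Input`);
in each round it may broadcast one message, the same one to all its neighbours, and then updates its
state using the messages that its neighbours broadcast in that round. -/
structure BCongestAlgorithm (Seed Input Msg Output : Type) where
  State : Type
  init : Seed → Input → State
  broadcast : State → Option Msg
  update : State → Multiset Msg → State
  output : State → Output

namespace BCongestAlgorithm

variable {Seed Input Msg Output : Type} {V : Type*} [Fintype V]

/-- The number of bits that suffice to write down any message of the algorithm. -/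
noncomputable def messageBits (_A : BCongestAlgorithm Seed Input Msg Output) : ℕ :=
  Nat.clog 2 (Nat.card Msg)

open Classical in
/-- The messages received by `v` when every node `u` broadcasts `b u` (`none`: `u` is silent). -/
noncomputable def inbox (G : SimpleGraph V) (b : V → Option Msg) (v : V) : Multiset Msg :=
  (Finset.univ.filter fun u => G.Adj v u).val.filterMap b

variable (A : BCongestAlgorithm Seed Input Msg Output) (G : SimpleGraph V)
  (seed : Seed) (input : V → Input)

/-- `A.run G seed input t v` is the state of node `v` after `t` rounds on the network `G`. -/
noncomputable def run : ℕ → V → A.State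
  | 0, v => A.init seed (input v)
  | t + 1, v => A.update (run t v) (inbox G (fun u => A.broadcast (run t u)) v)

/-- The broadcast of `v` in the round that follows the first `t` rounds (rounds are numbered from
`0`, so this is round `t`). -/
noncomputable def sent (t : ℕ) (v : V) : Option Msg :=
  A.broadcast (A.run G seed input t v)

/-- The output of `v` after `t` rounds. -/
noncomputable def outputAt (t : ℕ) (v : V) : Output :=
  A.output (A.run G seed input t v)

/-- The execution is complete after `T` rounds: no node broadcasts any more, and all outputs are
final. -/
def CompleteAfter (T : ℕ) : Prop :=
  ∀ t, T ≤ t → ∀ v, A.sent G seed input t v = none ∧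
    A.outputAt G seed input t v = A.outputAt G seed input T v

/-- The running time: the least number of rounds after which the execution is complete. -/
noncomputable def runningTime : ℕ :=
  sInf {T | A.CompleteAfter G seed input T}

/-- The final output of `v`. -/
noncomputable def finalOutput (v : V) : Output :=
  A.outputAt G seed input (A.runningTime G seed input) v

end BCongestAlgorithm

/-! ### The standard (partial) BFS algorithm -/

/-- The BFS result of a node: `none` if it was not reached, otherwise its hop distance from the
source together with the identifier of its parent (`none` for the source itself). -/
abbrev BFSLabel (N : ℕ) : Type := Option (ℕ × Option (Fin N))

/-- The state of a node in the BFS algorithm; `active` says that the node is going to broadcast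
in the coming round. -/
structure BFSState (N : ℕ) where
  ident : Fin N
  clock : ℕ
  label : BFSLabel N
  active : Bool

/-- The standard BFS algorithm up to depth `h` (`h = ⊤`: the full BFS). The input of a node is its
identifier and a bit saying whether it is the source. An exploration message consists of the
identifier of its sender. Each node broadcasts at most once: the source in round `0`, any other
node in the round after it first receives an exploration message. Nodes at distance `h` or more do
not broadcast. As parent a node takes the sender with the smallest identifier among those from
which it first received the exploration. -/
noncomputable def partialBFS (N : ℕ) (h : ℕ∞) :
    BCongestAlgorithm Unit (Fin N × Bool) (Fin N) (BFSLabel N) where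
  State := BFSState N
  init _ x :=
    { ident := x.1
      clock := 0
      label := if x.2 then some (0, none) else none
      active := x.2 && decide (0 < h) }
  broadcast s := if s.active then some s.ident else none
  update s M :=
    if hM : s.label = none ∧ M.toFinset.Nonempty then
      { ident := s.ident
        clock := s.clock + 1
        label := some (s.clock + 1, some (M.toFinset.min' hM.2))
        active := decide (((s.clock + 1 : ℕ) : ℕ∞) < h) }
    else
      { ident := s.ident
        clock := s.clock + 1
        label := s.label
        active := false }
  output s := s.label

open Classical in
/-- The local inputs of the BFS algorithm with source `s`. -/
noncomputable def bfsInput {V : Type*} {N : ℕ} (ident : V ↪ Fin N) (s : V) : V → Fin N × Bool :=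
  fun v => (ident v, decide (v = s))

/-! ### Collections of BFS algorithms and their joint execution -/

/-- A collection of `ℓ` partial BFS algorithms on a network with node set `V`, whose nodes have
distinct identifiers in `Fin N`; algorithm `j` is started at `source j` and explores up to depth
`depth j`. The sources are distinct. -/
structure BFSCollection (V : Type*) (N ℓ : ℕ) where
  ident : V ↪ Fin N
  source : Fin ℓ ↪ V
  depth : Fin ℓ → ℕ∞

namespace BFSCollection

variable {V : Type*} [Fintype V] {N ℓ : ℕ} (F : BFSCollection V N ℓ) (G : SimpleGraph V)

/-- The broadcast of `v` in round `t` of algorithm `j`, executed in isolation. -/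
noncomputable def sentAlone (j : Fin ℓ) (t : ℕ) (v : V) : Option (Fin N) :=
  (partialBFS N (F.depth j)).sent G () (bfsInput F.ident (F.source j)) t v

/-- The final output of `v` in algorithm `j`, executed in isolation. -/
noncomputable def outputAlone (j : Fin ℓ) (v : V) : BFSLabel N :=
  (partialBFS N (F.depth j)).finalOutput G () (bfsInput F.ident (F.source j)) v

/-- The maximum running time of any of the algorithms, executed in isolation. -/
noncomputable def dilation : ℕ :=
  Finset.univ.sup fun j : Fin ℓ =>
    (partialBFS N (F.depth j)).runningTime G () (bfsInput F.ident (F.source j))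

open Classical in
/-- The local inputs of a joint execution: a node knows its identifier, and of which of the `ℓ`
algorithms it is the source. -/
noncomputable def jointInput : V → Fin N × (Fin ℓ → Bool) :=
  fun v => (F.ident v, fun j => decide (v = F.source j))

end BFSCollection

/-- A BCONGEST algorithm that executes `ℓ` BFS algorithms together. The shared random string
consists of one delay per BFS algorithm. Each message `(j, m)` is a single message `m` of a single
BFS algorithm, tagged with the index `j` of that algorithm. A node outputs its result in each of
the BFS algorithms. -/
abbrev BFSScheduler (N ℓ : ℕ) : Type 1 :=
  BCongestAlgorithm (Fin ℓ → ℕ) (Fin N × (Fin ℓ → Bool)) (Fin ℓ × Fin N) (Fin ℓ → BFSLabel N)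

namespace BFSScheduler

variable {V : Type*} [Fintype V] {N ℓ : ℕ} (S : BFSScheduler N ℓ) (G : SimpleGraph V)
  (F : BFSCollection V N ℓ) (d : Fin ℓ → ℕ)

/-- With delays `d`, the scheduler executes every BFS algorithm `j` as is, but started after the
delay `d j`, when time is divided into phases of `L` consecutive BCONGEST rounds: what a node
broadcasts in round `r` of algorithm `j` in isolation, it broadcasts exactly once in phase
`d j + r`, and it broadcasts nothing else. -/
def ExecutesWithDelays (L : ℕ) : Prop :=
  ∀ (j : Fin ℓ) (v : V) (p : ℕ) (m : Fin N),
    ((∃ i < L, S.sent G d F.jointInput (p * L + i) v = some (j, m)) →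
      d j ≤ p ∧ F.sentAlone G j (p - d j) v = some m) ∧
    (d j ≤ p ∧ F.sentAlone G j (p - d j) v = some m →
      ∃! i, i < L ∧ S.sent G d F.jointInput (p * L + i) v = some (j, m))

/-- All BFS algorithms have completed after `T` rounds of the joint execution: from then on no node
broadcasts, and every node holds its output in each of the algorithms. -/
def AllCompleteAfter (T : ℕ) : Prop :=
  ∀ t, T ≤ t → ∀ v, S.sent G d F.jointInput t v = none ∧
    ∀ j, S.outputAt G d F.jointInput t v j = F.outputAlone G j v

/-- The BFS algorithms of which node `v` receives a message in round `t`. -/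
def receivedInRound (t : ℕ) (v : V) : Set (Fin ℓ) :=
  {j | ∃ u, G.Adj v u ∧ ∃ m, S.sent G d F.jointInput t u = some (j, m)}

/-- The BFS algorithms of which node `v` receives a message in phase `p`. -/
def receivedInPhase (L p : ℕ) (v : V) : Set (Fin ℓ) :=
  {j | ∃ i < L, j ∈ S.receivedInRound G F d (p * L + i) v}

end BFSScheduler

/-!
The scheduler divides time into phases of `L = ⌊(c + 12) log n⌋` rounds. At the start of phase `p` a
node knows the state of every BFS algorithm `j` after `p - d j` rounds, hence the list of messages
that it has to broadcast; it broadcasts them one per round and advances the algorithms at the end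
of the phase (`delayedScheduler`). If none of these lists is longer than `L`, every algorithm is
executed faithfully (`delayedScheduler.onSchedule`), so that all of them are complete after
`ℓ + dilation` phases. It remains to bound, for every node `v` and phase `p`, the number of
algorithms in which `v` or a neighbour of `v` broadcasts in phase `p` (`BFSCollection.busy`); this
also bounds the number of algorithms of which `v` receives a message.

The point is that a BFS passes the closed neighbourhood of `v` within three consecutive rounds
(`partialBFS.exists_active_window`). So algorithm `j` is busy around `v` in phase `p` for at most
three values of the delay `d j`, which has probability at most `3 / ℓ`. The delays are independent,
and the expectation of the exponential of the number of busy algorithms is at most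
`(1 + (e - 1) * 3 / ℓ) ^ ℓ ≤ e ^ 6`. By Markov's inequality more than `(c + 12) log n` algorithms are
busy with probability at most `e ^ 6 * n ^ (-(c + 12))` (`measure_lt_card_hits_le`). A BFS lasts at
most `n` rounds (`partialBFS.lt_card_of_active`), so only `2 * n` phases matter, and a union bound
over nodes and phases concludes (`BFSCollection.measure_congested_le`).
-/

/-! ### Rounds in which a partial BFS broadcasts -/

theorem BCongestAlgorithm.mem_inbox {Msg : Type} {V : Type*} [Fintype V] {G : SimpleGraph V}
    {b : V → Option Msg} {v : V} {m : Msg} :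
    m ∈ BCongestAlgorithm.inbox G b v ↔ ∃ u, G.Adj v u ∧ b u = some m := by
  simp [BCongestAlgorithm.inbox]

namespace partialBFS

variable {V : Type*} [Fintype V] {N : ℕ} (h : ℕ∞) (G : SimpleGraph V) (x : V → Fin N × Bool)

/-- The state of `v` after `t` rounds of the BFS algorithm with depth limit `h` and inputs `x`. -/
noncomputable def state (t : ℕ) (v : V) : BFSState N :=
  (partialBFS N h).run G () x t v

variable {h G x}

theorem state_zero (v : V) : state h G x 0 v = (partialBFS N h).init () (x v) := rfl

theorem sent_eq (t : ℕ) (v : V) : (partialBFS N h).sent G () x t v =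
    if (state h G x t v).active then some (state h G x t v).ident else none := rfl

theorem sent_ne_none {t : ℕ} {v : V} : (partialBFS N h).sent G () x t v ≠ none ↔
    (state h G x t v).active = true := by
  simp [sent_eq]

/-- The update rule depends only on which messages arrive, not on their multiplicities. -/
theorem update_congr (s : (partialBFS N h).State) {M M' : Multiset (Fin N)}
    (hM : ∀ m, m ∈ M ↔ m ∈ M') : (partialBFS N h).update s M = (partialBFS N h).update s M' := by
  have : M.toFinset = M'.toFinset := by ext m; simp [hM]
  simp only [partialBFS, this]

theorem inbox_nonempty {t : ℕ} {v : V} :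
    (BCongestAlgorithm.inbox G (fun u => (partialBFS N h).sent G () x t u) v).toFinset.Nonempty ↔
      ∃ u, G.Adj v u ∧ (state h G x t u).active = true := by
  simp [Finset.Nonempty, BCongestAlgorithm.mem_inbox, sent_eq]

theorem state_succ_of_pos {t : ℕ} {v : V} (hl : (state h G x t v).label = none)
    (hu : ∃ u, G.Adj v u ∧ (state h G x t u).active = true) :
    ∃ m, state h G x (t + 1) v =
      ⟨(state h G x t v).ident, (state h G x t v).clock + 1,
        some ((state h G x t v).clock + 1, some m),
        decide ((((state h G x t v).clock + 1 : ℕ) : ℕ∞) < h)⟩ :=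
  ⟨_, dif_pos ⟨hl, inbox_nonempty.2 hu⟩⟩

theorem state_succ_of_neg {t : ℕ} {v : V} (hs : ¬ ((state h G x t v).label = none ∧
      ∃ u, G.Adj v u ∧ (state h G x t u).active = true)) :
    state h G x (t + 1) v =
      ⟨(state h G x t v).ident, (state h G x t v).clock + 1, (state h G x t v).label, false⟩ :=
  dif_neg fun hh => hs ⟨hh.1, inbox_nonempty.1 hh.2⟩

theorem clock_state (t : ℕ) (v : V) : (state h G x t v).clock = t := by
  induction t with
  | zero => rfl
  | succ t ih =>
    by_cases hs : (state h G x t v).label = none ∧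
      ∃ u, G.Adj v u ∧ (state h G x t u).active = true
    · obtain ⟨m, hm⟩ := state_succ_of_pos hs.1 hs.2
      simp [hm, ih]
    · simp [state_succ_of_neg hs, ih]

/-- A labelled node keeps its label and falls silent. -/
theorem state_succ_of_label_ne {t : ℕ} {v : V} (hl : (state h G x t v).label ≠ none) :
    (state h G x (t + 1) v).label = (state h G x t v).label ∧
      (state h G x (t + 1) v).active = false := by
  rw [state_succ_of_neg fun hs => hl hs.1]
  exact ⟨rfl, rfl⟩

/-- An unlabelled node none of whose neighbours broadcasts stays unlabelled and silent. -/
theorem state_succ_of_silent {t : ℕ} {v : V}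
    (hu : ¬ ∃ u, G.Adj v u ∧ (state h G x t u).active = true) :
    (state h G x (t + 1) v).label = (state h G x t v).label ∧
      (state h G x (t + 1) v).active = false := by
  rw [state_succ_of_neg fun hs => hu hs.2]
  exact ⟨rfl, rfl⟩

/-- A node that first hears an exploration message is labelled, and broadcasts next if the depth
limit allows. -/
theorem state_succ_of_heard {t : ℕ} {v : V} (hl : (state h G x t v).label = none)
    (hu : ∃ u, G.Adj v u ∧ (state h G x t u).active = true) :
    (state h G x (t + 1) v).label ≠ none ∧
      ((state h G x (t + 1) v).active = true ↔ ((t + 1 : ℕ) : ℕ∞) < h) := by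
  obtain ⟨m, hm⟩ := state_succ_of_pos hl hu
  rw [hm, clock_state]
  exact ⟨by simp, decide_eq_true_iff⟩

theorem label_ne_none_mono {t t' : ℕ} (htt : t ≤ t') {v : V}
    (hl : (state h G x t v).label ≠ none) : (state h G x t' v).label ≠ none := by
  induction t', htt using Nat.le_induction with
  | base => exact hl
  | succ t' _ ih => rwa [(state_succ_of_label_ne ih).1]

theorem label_zero (v : V) : (state h G x 0 v).label ≠ none ↔ (x v).2 = true := by
  rw [state_zero]; simp [partialBFS]

theorem active_zero (v : V) :
    (state h G x 0 v).active = true ↔ (x v).2 = true ∧ 0 < h := by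
  rw [state_zero]; simp [partialBFS]

/-- A node broadcasts in round `t` exactly if it is first labelled after `t` rounds and `t` is below
the depth limit. -/
theorem active_iff {t : ℕ} {v : V} : (state h G x t v).active = true ↔
    (state h G x t v).label ≠ none ∧ (∀ t' < t, (state h G x t' v).label = none) ∧
      (t : ℕ∞) < h := by
  cases t with
  | zero => rw [active_zero, label_zero]; simp
  | succ t =>
    by_cases hl : (state h G x t v).label = none
    · have hprev : ∀ t' < t + 1, (state h G x t' v).label = none := by
        intro t' ht'
        by_contra hne
        exact label_ne_none_mono (Nat.lt_succ_iff.1 ht') hne hl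
      by_cases hu : ∃ u, G.Adj v u ∧ (state h G x t u).active = true
      · have := state_succ_of_heard hl hu
        tauto
      · have := state_succ_of_silent hu
        rw [this.1, this.2]
        simp [hl]
    · rw [(state_succ_of_label_ne hl).2]
      simp only [Bool.false_eq_true, false_iff]
      exact fun hh => hl (hh.2.1 t (Nat.lt_succ_self t))

theorem label_of_adj_active {t : ℕ} {u v : V} (huv : G.Adj v u)
    (hu : (state h G x t u).active = true) : (state h G x (t + 1) v).label ≠ none := by
  by_cases hl : (state h G x t v).label = none
  · exact (state_succ_of_heard hl ⟨u, huv, hu⟩).1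
  · exact label_ne_none_mono t.le_succ hl

theorem active_unique {t t' : ℕ} {v : V} (ht : (state h G x t v).active = true)
    (ht' : (state h G x t' v).active = true) : t = t' := by
  rw [active_iff] at ht ht'
  rcases lt_trichotomy t t' with hlt | heq | hlt
  · exact absurd (ht'.2.1 _ hlt) ht.1
  · exact heq
  · exact absurd (ht.2.1 _ hlt) ht'.1

/-- The BFS wavefront passes the closed neighbourhood of a node within three consecutive rounds:
if `v` is first labelled after `r` rounds, then `v` and its neighbours broadcast at most in the
rounds `r - 1`, `r` and `r + 1`. -/
theorem exists_active_window (h : ℕ∞) (G : SimpleGraph V) (x : V → Fin N × Bool) (v : V) :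
    ∃ r : ℕ, ∀ t u, (u = v ∨ G.Adj v u) →
      (partialBFS N h).sent G () x t u ≠ none → t ∈ Finset.Icc (r - 1) (r + 1) := by
  simp only [sent_ne_none]
  by_cases hv : ∃ t, (state h G x t v).label ≠ none
  · classical
    set r := Nat.find hv with hr
    have hlab : (state h G x r v).label ≠ none := Nat.find_spec hv
    have hfirst : ∀ t < r, (state h G x t v).label = none := fun t ht => by
      simpa using Nat.find_min hv ht
    refine ⟨r, fun t u hu hact => ?_⟩
    rw [Finset.mem_Icc]
    rcases hu with rfl | hu
    · have : r ≤ t := Nat.find_min' hv (active_iff.1 hact).1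
      have : ¬ r < t := fun hlt => hlab ((active_iff.1 hact).2.1 r hlt)
      omega
    · have h1 : r ≤ t + 1 := Nat.find_min' hv (label_of_adj_active hu hact)
      have h2 : t ≤ r + 1 := by
        by_contra hlt
        have hth := active_iff.1 hact
        -- `t` is below the depth limit, hence so is `r`: `v` broadcasts in round `r`
        have hrh : (r : ℕ∞) < h := lt_trans (by exact_mod_cast (by omega : r < t)) hth.2.2
        exact label_of_adj_active hu.symm (active_iff.2 ⟨hlab, hfirst, hrh⟩)
          (hth.2.1 (r + 1) (by omega))
      omega
  · refine ⟨0, fun t u hu hact => absurd ?_ hv⟩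
    rcases hu with rfl | hu
    · exact ⟨t, (active_iff.1 hact).1⟩
    · exact ⟨t + 1, label_of_adj_active hu hact⟩

theorem exists_active_of_succ {t : ℕ} {v : V} (hv : (state h G x (t + 1) v).active = true) :
    ∃ u, (state h G x t u).active = true := by
  by_contra hu
  rw [(state_succ_of_silent (fun ⟨u, _, h⟩ => hu ⟨u, h⟩)).2] at hv
  exact Bool.false_ne_true hv

theorem exists_active_of_le {t t' : ℕ} (htt : t' ≤ t) {v : V}
    (hv : (state h G x t v).active = true) : ∃ u, (state h G x t' u).active = true := by
  induction t, htt using Nat.le_induction generalizing v with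
  | base => exact ⟨v, hv⟩
  | succ t _ ih => obtain ⟨u, hu⟩ := exists_active_of_succ hv; exact ih hu

/-- If some node broadcasts in round `t`, then so does a different one in each earlier round;
hence `t` is less than the number of nodes. -/
theorem lt_card_of_active {t : ℕ} {v : V} (hv : (state h G x t v).active = true) :
    t < Fintype.card V := by
  choose f hf using fun i : Fin (t + 1) => exists_active_of_le (Nat.lt_succ_iff.1 i.2) hv
  have hinj : Function.Injective f := fun i j hij =>
    Fin.ext (active_unique (hf i) (hij ▸ hf j))
  simpa using Fintype.card_le_of_injective f hinj

theorem completeAfter_card (h : ℕ∞) (G : SimpleGraph V) (x : V → Fin N × Bool) :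
    (partialBFS N h).CompleteAfter G () x (Fintype.card V) := by
  have hsil : ∀ t, Fintype.card V ≤ t → ∀ u, ¬ (state h G x t u).active = true :=
    fun t ht u hu => absurd (lt_card_of_active hu) (by omega)
  intro t ht v
  refine ⟨by simpa [sent_eq] using hsil t ht v, ?_⟩
  change (state h G x t v).label = (state h G x (Fintype.card V) v).label
  induction t, ht using Nat.le_induction with
  | base => rfl
  | succ t ht ih =>
    rw [← ih]
    exact (state_succ_of_silent fun ⟨u, _, hu⟩ => hsil t ht u hu).1

theorem completeAfter_runningTime (h : ℕ∞) (G : SimpleGraph V) (x : V → Fin N × Bool) :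
    (partialBFS N h).CompleteAfter G () x ((partialBFS N h).runningTime G () x) :=
  Nat.sInf_mem (s := {T | (partialBFS N h).CompleteAfter G () x T})
    ⟨_, completeAfter_card h G x⟩

end partialBFS

/-! ### The random-delay scheduler -/

/-- The state of a node in the joint execution: the delays, the number of rounds so far, the current
state of each simulated BFS algorithm, and the messages received so far in the current phase. -/
structure DelayedState (N ℓ : ℕ) (h : Fin ℓ → ℕ∞) where
  delay : Fin ℓ → ℕ
  time : ℕ
  sim : ∀ j, (partialBFS N (h j)).State
  buffer : Multiset (Fin ℓ × Fin N)

/-- The messages that a node has to broadcast in phase `p`, ordered by algorithm, if `m j` is the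
next broadcast of algorithm `j`. -/
def phaseQueue {N ℓ : ℕ} (d : Fin ℓ → ℕ) (p : ℕ) (m : Fin ℓ → Option (Fin N)) :
    List (Fin ℓ × Fin N) :=
  (List.finRange ℓ).filterMap fun j => if d j ≤ p then (m j).map (Prod.mk j) else none

/-- The random-delay scheduler with phases of `L` rounds. In round `i` of a phase a node broadcasts
the `i`-th message of its queue for that phase; at the end of the phase it advances every BFS
algorithm whose delay has elapsed by one round, using the messages collected during the phase. -/
noncomputable def delayedScheduler (N ℓ : ℕ) (h : Fin ℓ → ℕ∞) (L : ℕ) : BFSScheduler N ℓ where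
  State := DelayedState N ℓ h
  init d x :=
    { delay := d
      time := 0
      sim := fun j => (partialBFS N (h j)).init () (x.1, x.2 j)
      buffer := 0 }
  broadcast s :=
    (phaseQueue s.delay (s.time / L) fun j => (partialBFS N (h j)).broadcast (s.sim j))[s.time % L]?
  update s M :=
    if s.time % L + 1 = L then
      { delay := s.delay
        time := s.time + 1
        sim := fun j =>
          if s.delay j ≤ s.time / L then
            (partialBFS N (h j)).update (s.sim j)
              ((s.buffer + M).filterMap fun x => if x.1 = j then some x.2 else none)
          else s.sim j
        buffer := 0 }
    else
      { delay := s.delay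
        time := s.time + 1
        sim := s.sim
        buffer := s.buffer + M }
  output s j := (partialBFS N (h j)).output (s.sim j)

section phaseQueue

variable {N ℓ : ℕ} {d : Fin ℓ → ℕ} {p : ℕ} {m : Fin ℓ → Option (Fin N)}

theorem mem_phaseQueue {x : Fin ℓ × Fin N} :
    x ∈ phaseQueue d p m ↔ d x.1 ≤ p ∧ m x.1 = some x.2 := by
  obtain ⟨j, y⟩ := x
  simp only [phaseQueue, List.mem_filterMap, List.mem_finRange, true_and]
  constructor
  · rintro ⟨i, hi⟩
    split_ifs at hi with hd
    obtain ⟨z, hz, hzy⟩ := Option.map_eq_some_iff.1 hi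
    cases hzy
    exact ⟨hd, hz⟩
  · rintro ⟨hd, hm⟩
    exact ⟨j, by simp_all⟩

theorem nodup_phaseQueue : (phaseQueue d p m).Nodup := by
  refine List.Nodup.filterMap ?_ (List.nodup_finRange ℓ)
  intro i j x hi hj
  simp only [Option.mem_def] at hi hj
  split_ifs at hi hj
  obtain ⟨_, _, rfl⟩ := Option.map_eq_some_iff.1 hi
  obtain ⟨_, _, h⟩ := Option.map_eq_some_iff.1 hj
  exact (Prod.ext_iff.1 h).1.symm

theorem length_phaseQueue_le :
    (phaseQueue d p m).length ≤ {j | d j ≤ p ∧ m j ≠ none}.ncard := by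
  classical
  have hinj : Set.InjOn Prod.fst {x | x ∈ phaseQueue d p m} := by
    rintro ⟨i, x⟩ hx ⟨j, y⟩ hy (rfl : i = j)
    have hx := (mem_phaseQueue.1 hx).2
    have hy := (mem_phaseQueue.1 hy).2
    simp_all
  have hcard : {x | x ∈ phaseQueue d p m}.ncard = (phaseQueue d p m).length := by
    rw [← List.toFinset_card_of_nodup nodup_phaseQueue, ← Set.ncard_coe_finset]
    congr 1
    ext; simp
  rw [← hcard]
  refine Set.ncard_le_ncard_of_injOn Prod.fst (fun x hx => ?_) hinj (Set.toFinite _)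
  have := mem_phaseQueue.1 hx
  exact ⟨this.1, by simp [this.2]⟩

end phaseQueue

namespace BFSCollection

variable {V : Type*} [Fintype V] {N ℓ : ℕ} (F : BFSCollection V N ℓ) (G : SimpleGraph V)
  (d : Fin ℓ → ℕ)

/-- The messages that `v` has to broadcast in phase `p` of the joint execution with delays `d`. -/
noncomputable def queue (p : ℕ) (v : V) : List (Fin ℓ × Fin N) :=
  phaseQueue d p fun j => F.sentAlone G j (p - d j) v

/-- The algorithms in which a node of the closed neighbourhood of `v` broadcasts in phase `p` of the
joint execution with delays `d`. -/
def busy (p : ℕ) (v : V) : Set (Fin ℓ) :=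
  {j | d j ≤ p ∧ ∃ u, (u = v ∨ G.Adj v u) ∧ F.sentAlone G j (p - d j) u ≠ none}

theorem length_queue_le (p : ℕ) (v : V) : (F.queue G d p v).length ≤ (F.busy G d p v).ncard :=
  length_phaseQueue_le.trans <|
    Set.ncard_le_ncard (fun _ hj => ⟨hj.1, v, Or.inl rfl, hj.2⟩) (Set.toFinite _)

theorem runningTime_le_dilation (j : Fin ℓ) :
    (partialBFS N (F.depth j)).runningTime G () (bfsInput F.ident (F.source j)) ≤ F.dilation G :=
  Finset.le_sup (f := fun j : Fin ℓ =>
    (partialBFS N (F.depth j)).runningTime G () (bfsInput F.ident (F.source j))) (Finset.mem_univ j)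

end BFSCollection

namespace delayedScheduler

variable {V : Type*} [Fintype V] {N ℓ : ℕ} {F : BFSCollection V N ℓ} {G : SimpleGraph V}
  {d : Fin ℓ → ℕ} {L : ℕ}

/-- The state of `v` after `t` rounds of the joint execution. -/
noncomputable def state (F : BFSCollection V N ℓ) (G : SimpleGraph V) (d : Fin ℓ → ℕ) (L t : ℕ)
    (v : V) : DelayedState N ℓ F.depth :=
  (delayedScheduler N ℓ F.depth L).run G d F.jointInput t v

/-- The joint execution is on schedule at node `v` after `t` rounds: each BFS algorithm has been
simulated up to the current phase, and the buffer holds what has been received in this phase. -/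
structure OnSchedule (F : BFSCollection V N ℓ) (G : SimpleGraph V) (d : Fin ℓ → ℕ) (L t : ℕ)
    (v : V) : Prop where
  delay : (state F G d L t v).delay = d
  time : (state F G d L t v).time = t
  sim : ∀ j, (state F G d L t v).sim j = (partialBFS N (F.depth j)).run G ()
    (bfsInput F.ident (F.source j)) (t / L - d j) v
  buffer : ∀ x, x ∈ (state F G d L t v).buffer ↔
    ∃ i < t % L, ∃ u, G.Adj v u ∧ (F.queue G d (t / L) u)[i]? = some x

theorem OnSchedule.sent_eq {t : ℕ} {v : V} (hs : OnSchedule F G d L t v) :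
    (delayedScheduler N ℓ F.depth L).sent G d F.jointInput t v =
      (F.queue G d (t / L) v)[t % L]? := by
  change (phaseQueue (state F G d L t v).delay ((state F G d L t v).time / L) fun j =>
    (partialBFS N (F.depth j)).broadcast ((state F G d L t v).sim j))[
      (state F G d L t v).time % L]? = _
  rw [hs.delay, hs.time]
  simp only [hs.sim]
  rfl

theorem state_succ (t : ℕ) (v : V) : state F G d L (t + 1) v =
    (delayedScheduler N ℓ F.depth L).update (state F G d L t v)
      (BCongestAlgorithm.inbox G
        (fun u => (delayedScheduler N ℓ F.depth L).sent G d F.jointInput t u) v) := rfl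

theorem onSchedule_succ (hL : 0 < L) (hq : ∀ p v, (F.queue G d p v).length ≤ L) {t : ℕ}
    (ht : ∀ v, OnSchedule F G d L t v) (v : V) : OnSchedule F G d L (t + 1) v := by
  have hv := ht v
  set M := BCongestAlgorithm.inbox G
    (fun u => (delayedScheduler N ℓ F.depth L).sent G d F.jointInput t u) v with hM
  have hbuf : ∀ x, x ∈ (state F G d L t v).buffer + M ↔
      ∃ i < t % L + 1, ∃ u, G.Adj v u ∧ (F.queue G d (t / L) u)[i]? = some x := by
    intro x
    rw [Multiset.mem_add, hv.buffer, hM, BCongestAlgorithm.mem_inbox]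
    simp only [(ht _).sent_eq, Nat.lt_succ_iff_lt_or_eq, or_and_right, exists_or, exists_eq_left]
  have hlt := Nat.mod_lt t hL
  have hdm := Nat.div_add_mod t L
  by_cases hend : t % L + 1 = L
  · have hs : state F G d L (t + 1) v =
        { delay := (state F G d L t v).delay
          time := (state F G d L t v).time + 1
          sim := fun j =>
            if (state F G d L t v).delay j ≤ (state F G d L t v).time / L then
              (partialBFS N (F.depth j)).update ((state F G d L t v).sim j)
                (((state F G d L t v).buffer + M).filterMap
                  fun x => if x.1 = j then some x.2 else none)
            else (state F G d L t v).sim j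
          buffer := 0 } := by
      rw [state_succ]; exact if_pos (by rw [hv.time]; exact hend)
    have hsucc : t + 1 = (t / L + 1) * L := by
      rw [add_mul, one_mul, mul_comm]; omega
    have hdiv : (t + 1) / L = t / L + 1 := by rw [hsucc, Nat.mul_div_cancel _ hL]
    have hmod : (t + 1) % L = 0 := by rw [hsucc, Nat.mul_mod_left]
    refine ⟨by rw [hs]; exact hv.delay, by rw [hs]; simp [hv.time], fun j => ?_, fun x => ?_⟩
    · rw [hs, hdiv]
      simp only [hv.delay, hv.time, hv.sim]
      split_ifs with hd
      · rw [Nat.sub_add_comm hd, BCongestAlgorithm.run]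
        refine partialBFS.update_congr _ fun m => ?_
        rw [BCongestAlgorithm.mem_inbox, Multiset.mem_filterMap]
        have hx : (∃ x ∈ (state F G d L t v).buffer + M,
            (if x.1 = j then some x.2 else none) = some m) ↔
            (j, m) ∈ (state F G d L t v).buffer + M := by
          constructor
          · rintro ⟨⟨i, y⟩, hmem, h⟩
            split_ifs at h with hij
            cases h; cases hij
            exact hmem
          · exact fun hmem => ⟨_, hmem, by simp⟩
        rw [hx, hbuf]
        constructor
        · rintro ⟨i, -, u, hu, hi⟩
          exact ⟨u, hu, (mem_phaseQueue.1 (List.mem_of_getElem? hi)).2⟩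
        · rintro ⟨u, hu, hm⟩
          have hmem : (j, m) ∈ F.queue G d (t / L) u := mem_phaseQueue.2 ⟨hd, hm⟩
          obtain ⟨i, hi, hget⟩ := List.mem_iff_getElem.1 hmem
          refine ⟨i, ?_, u, hu, by rw [List.getElem?_eq_getElem hi, hget]⟩
          have := hq (t / L) u
          omega
      · rw [show t / L + 1 - d j = t / L - d j by omega]
    · rw [hs, hmod]; simp
  · have hs : state F G d L (t + 1) v =
        { delay := (state F G d L t v).delay
          time := (state F G d L t v).time + 1
          sim := (state F G d L t v).sim
          buffer := (state F G d L t v).buffer + M } := by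
      rw [state_succ]; exact if_neg (by rw [hv.time]; exact hend)
    have hdiv : (t + 1) / L = t / L := by
      rw [Nat.div_eq_iff hL]
      constructor
      · rw [mul_comm]; omega
      · rw [mul_comm]; omega
    have hmod : (t + 1) % L = t % L + 1 := by
      have := Nat.div_add_mod (t + 1) L
      rw [hdiv] at this
      omega
    refine ⟨by rw [hs]; exact hv.delay, by rw [hs]; simp [hv.time], fun j => ?_, fun x => ?_⟩
    · rw [hs, hdiv]; exact hv.sim j
    · rw [hs, hdiv, hmod]; exact hbuf x

/-- If no queue is longer than a phase, then the joint execution never falls behind. -/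
theorem onSchedule (hL : 0 < L) (hq : ∀ p v, (F.queue G d p v).length ≤ L) (t : ℕ) (v : V) :
    OnSchedule F G d L t v := by
  induction t generalizing v with
  | zero =>
    refine ⟨rfl, rfl, fun j => ?_, fun x => ?_⟩
    · rw [Nat.zero_div, Nat.zero_sub]; rfl
    · simp [state, BCongestAlgorithm.run, delayedScheduler]
  | succ t ih => exact onSchedule_succ hL hq ih v

theorem sent_eq (hL : 0 < L) (hq : ∀ p v, (F.queue G d p v).length ≤ L) (t : ℕ) (v : V) :
    (delayedScheduler N ℓ F.depth L).sent G d F.jointInput t v =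
      (F.queue G d (t / L) v)[t % L]? := (onSchedule hL hq t v).sent_eq

theorem sent_phase_eq (hL : 0 < L) (hq : ∀ p v, (F.queue G d p v).length ≤ L) {i : ℕ} (hi : i < L)
    (p : ℕ) (v : V) : (delayedScheduler N ℓ F.depth L).sent G d F.jointInput (p * L + i) v =
      (F.queue G d p v)[i]? := by
  rw [sent_eq hL hq, mul_comm, Nat.mul_add_div hL, Nat.div_eq_of_lt hi, Nat.mul_add_mod,
    Nat.mod_eq_of_lt hi, add_zero]

theorem executesWithDelays (hL : 0 < L) (hq : ∀ p v, (F.queue G d p v).length ≤ L) :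
    (delayedScheduler N ℓ F.depth L).ExecutesWithDelays G F d L := by
  intro j v p m
  constructor
  · rintro ⟨i, hi, hsent⟩
    rw [sent_phase_eq hL hq hi] at hsent
    exact mem_phaseQueue.1 (List.mem_of_getElem? hsent)
  · intro hm
    have hmem : (j, m) ∈ F.queue G d p v := mem_phaseQueue.2 hm
    obtain ⟨i, hi, hget⟩ := List.mem_iff_getElem.1 hmem
    have hiL : i < L := hi.trans_le (hq p v)
    refine ⟨i, ⟨hiL, ?_⟩, ?_⟩
    · simp only [sent_phase_eq hL hq hiL, List.getElem?_eq_getElem hi, hget]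
    · rintro i' ⟨hi', hsent⟩
      rw [sent_phase_eq hL hq hi'] at hsent
      obtain ⟨hlt, hget'⟩ := List.getElem?_eq_some_iff.1 hsent
      exact (List.Nodup.getElem_inj_iff nodup_phaseQueue).1 (hget'.trans hget.symm)

theorem allCompleteAfter (hL : 0 < L) (hq : ∀ p v, (F.queue G d p v).length ≤ L)
    (hd : ∀ j, d j ≤ ℓ) :
    (delayedScheduler N ℓ F.depth L).AllCompleteAfter G F d (L * (ℓ + F.dilation G)) := by
  intro t ht v
  have hp : ℓ + F.dilation G ≤ t / L := (Nat.le_div_iff_mul_le hL).2 (by rwa [mul_comm])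
  have hr : ∀ j, (partialBFS N (F.depth j)).runningTime G () (bfsInput F.ident (F.source j)) ≤
      t / L - d j := fun j => by
    have := F.runningTime_le_dilation G j
    have := hd j
    omega
  constructor
  · rw [sent_eq hL hq, List.getElem?_eq_none_iff]
    have hnil : F.queue G d (t / L) v = [] := by
      refine List.eq_nil_iff_forall_not_mem.2 fun x hx => ?_
      have hx := (mem_phaseQueue.1 hx).2
      have := (partialBFS.completeAfter_runningTime _ G _ _ (hr x.1) v).1
      rw [BFSCollection.sentAlone, this] at hx
      cases hx
    simp [hnil]
  · intro j
    change (partialBFS N (F.depth j)).output ((state F G d L t v).sim j) = _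
    rw [(onSchedule hL hq t v).sim j]
    exact (partialBFS.completeAfter_runningTime _ G _ _ (hr j) v).2

theorem receivedInPhase_subset (hL : 0 < L) (hq : ∀ p v, (F.queue G d p v).length ≤ L) (p : ℕ)
    (v : V) :
    (delayedScheduler N ℓ F.depth L).receivedInPhase G F d L p v ⊆ F.busy G d p v := by
  rintro j ⟨i, hi, u, hu, m, hsent⟩
  rw [sent_phase_eq hL hq hi] at hsent
  obtain ⟨h1, h2⟩ := mem_phaseQueue.1 (List.mem_of_getElem? hsent)
  exact ⟨h1, u, Or.inr hu, by simp_all⟩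

end delayedScheduler

theorem BFSScheduler.receivedInRound_subset {V : Type*} [Fintype V] {N ℓ : ℕ}
    (S : BFSScheduler N ℓ) (G : SimpleGraph V) (F : BFSCollection V N ℓ) (d : Fin ℓ → ℕ) {L : ℕ}
    (hL : 0 < L) (t : ℕ) (v : V) :
    S.receivedInRound G F d t v ⊆ S.receivedInPhase G F d L (t / L) v := by
  intro j hj
  refine ⟨t % L, Nat.mod_lt t hL, ?_⟩
  rwa [mul_comm, Nat.div_add_mod]

/-! ### A Chernoff bound for uniform delays -/

theorem uniformOn_Icc_finset_le (ℓ : ℕ) (D : Finset ℕ) :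
    uniformOn (Set.Icc 1 ℓ) (D : Set ℕ) ≤ (D.card : ENNReal) / ℓ := by
  rw [← Finset.coe_Icc, uniformOn_apply_finset, Nat.card_Icc, Nat.add_sub_cancel]
  gcongr
  exact Finset.inter_subset_right

/-- A Chernoff bound for the number of independent uniform delays that hit prescribed sets of at
most three values each. -/
theorem measure_lt_card_hits_le {Ω : Type*} [MeasurableSpace Ω] {μ : Measure Ω}
    {ℓ : ℕ} {d : Fin ℓ → Ω → ℕ} (hd : ∀ j, Measurable (d j)) (hind : iIndepFun d μ)
    (hunif : ∀ j, μ.map (d j) = uniformOn (Set.Icc 1 ℓ)) (D : Fin ℓ → Finset ℕ)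
    (hD : ∀ j, (D j).card ≤ 3) (K : ℝ) :
    μ {ω | K < ({j | d j ω ∈ D j}.ncard : ℝ)} ≤ ENNReal.ofReal (Real.exp (6 - K)) := by
  classical
  have := hind.isProbabilityMeasure
  set f : Fin ℓ → ℕ → ENNReal :=
    fun j x => if x ∈ D j then ENNReal.ofReal (Real.exp 1) else 1 with hf
  have hfm : ∀ j, Measurable (f j) := fun j => measurable_of_countable _
  -- `∏ j, f j (d j)` is the exponential of the number of hits
  have hprod : ∀ ω, ∏ j, f j (d j ω) =
      ENNReal.ofReal (Real.exp ({j | d j ω ∈ D j}.ncard : ℝ)) := by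
    intro ω
    have hcard : {j | d j ω ∈ D j}.ncard = (Finset.univ.filter fun j => d j ω ∈ D j).card := by
      rw [← Set.ncard_coe_finset]; congr 1; ext; simp
    rw [hcard, Finset.prod_ite, Finset.prod_const_one, mul_one, Finset.prod_const,
      ← ENNReal.ofReal_pow (Real.exp_nonneg _), ← Real.exp_nat_mul, mul_one]
  have hone : ∀ j, ∫⁻ ω, f j (d j ω) ∂μ ≤ ENNReal.ofReal (Real.exp (6 / ℓ)) := by
    intro j
    have hℓ : 0 < ℓ := j.pos
    have hμ : μ (d j ⁻¹' (D j : Set ℕ)) ≤ ENNReal.ofReal (3 / ℓ) := by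
      rw [← Measure.map_apply (hd j) (Set.to_countable _).measurableSet, hunif j,
        ENNReal.ofReal_div_of_pos (by exact_mod_cast hℓ), ENNReal.ofReal_natCast]
      refine (uniformOn_Icc_finset_le ℓ (D j)).trans ?_
      gcongr
      have := hD j
      simpa using (by exact_mod_cast this : ((D j).card : ENNReal) ≤ 3)
    -- `e ≤ 1 + 2`
    have hle : ∀ ω, f j (d j ω) ≤
        1 + (d j ⁻¹' (D j : Set ℕ)).indicator (fun _ => ENNReal.ofReal 2) ω := by
      intro ω
      by_cases hω : d j ω ∈ D j
      · have h3 : Real.exp 1 ≤ 1 + 2 := by linarith [Real.exp_one_lt_d9]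
        simp only [hf, hω, if_true, Set.indicator, Set.mem_preimage, Finset.mem_coe]
        rw [← ENNReal.ofReal_one, ← ENNReal.ofReal_add zero_le_one zero_le_two]
        exact ENNReal.ofReal_le_ofReal h3
      · simp [hf, hω]
    calc ∫⁻ ω, f j (d j ω) ∂μ
        ≤ ∫⁻ ω, 1 + (d j ⁻¹' (D j : Set ℕ)).indicator (fun _ => ENNReal.ofReal 2) ω ∂μ :=
          lintegral_mono hle
      _ = 1 + ENNReal.ofReal 2 * μ (d j ⁻¹' (D j : Set ℕ)) := by
          rw [lintegral_add_left measurable_const, lintegral_const, measure_univ, mul_one,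
            lintegral_indicator_const (hd j (Set.to_countable _).measurableSet)]
      _ ≤ 1 + ENNReal.ofReal 2 * ENNReal.ofReal (3 / ℓ) := by gcongr
      _ = ENNReal.ofReal (6 / ℓ + 1) := by
          rw [← ENNReal.ofReal_mul zero_le_two, add_comm (6 / (ℓ : ℝ)),
            ENNReal.ofReal_add zero_le_one (by positivity), ENNReal.ofReal_one]
          congr 2; ring
      _ ≤ ENNReal.ofReal (Real.exp (6 / ℓ)) := ENNReal.ofReal_le_ofReal (Real.add_one_le_exp _)
  have hexp : ∫⁻ ω, ∏ j, f j (d j ω) ∂μ ≤ ENNReal.ofReal (Real.exp 6) := by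
    have hmul : ∫⁻ ω, ∏ j, f j (d j ω) ∂μ = ∏ j, ∫⁻ ω, f j (d j ω) ∂μ :=
      lintegral_prod_eq_prod_lintegral_of_indepFun Finset.univ (fun j ω => f j (d j ω))
        (hind.comp f hfm) fun j => (hfm j).comp (hd j)
    rw [hmul]
    refine (Finset.prod_le_prod' fun j _ => hone j).trans ?_
    rw [Finset.prod_const, Finset.card_univ, Fintype.card_fin,
      ← ENNReal.ofReal_pow (Real.exp_nonneg _), ← Real.exp_nat_mul]
    refine ENNReal.ofReal_le_ofReal (Real.exp_le_exp.2 ?_)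
    rcases Nat.eq_zero_or_pos ℓ with rfl | hℓ
    · norm_num
    · rw [mul_div_cancel₀ _ (by positivity)]
  have hK : ENNReal.ofReal (Real.exp K) ≠ 0 := by simpa using Real.exp_pos K
  calc μ {ω | K < ({j | d j ω ∈ D j}.ncard : ℝ)}
      ≤ μ {ω | ENNReal.ofReal (Real.exp K) ≤ ∏ j, f j (d j ω)} := by
        refine measure_mono fun ω hω => ?_
        rw [Set.mem_ofPred_eq, hprod]
        exact ENNReal.ofReal_le_ofReal (Real.exp_le_exp.2 (le_of_lt hω))
    _ ≤ (∫⁻ ω, ∏ j, f j (d j ω) ∂μ) / ENNReal.ofReal (Real.exp K) :=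
        meas_ge_le_lintegral_div
          (Finset.measurable_prod _ fun j _ => (hfm j).comp (hd j)).aemeasurable hK
          ENNReal.ofReal_ne_top
    _ ≤ ENNReal.ofReal (Real.exp 6) / ENNReal.ofReal (Real.exp K) := by gcongr
    _ = ENNReal.ofReal (Real.exp (6 - K)) := by
        rw [← ENNReal.ofReal_div_of_pos (Real.exp_pos K), Real.exp_sub]

/-! ### Congestion under random delays -/

namespace BFSCollection

variable {V : Type*} [Fintype V] {N ℓ : ℕ} (F : BFSCollection V N ℓ) (G : SimpleGraph V)

/-- In a fixed phase, an algorithm is busy around `v` for at most three values of its delay. -/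
theorem exists_delays_of_busy (p : ℕ) (v : V) : ∃ D : Fin ℓ → Finset ℕ, (∀ j, (D j).card ≤ 3) ∧
    ∀ d : Fin ℓ → ℕ, F.busy G d p v ⊆ {j | d j ∈ D j} := by
  choose r hr using fun j : Fin ℓ =>
    partialBFS.exists_active_window (F.depth j) G (bfsInput F.ident (F.source j)) v
  refine ⟨fun j => (Finset.Icc (r j - 1) (r j + 1)).image (p - ·), fun j => ?_, fun d j hj => ?_⟩
  · refine Finset.card_image_le.trans ?_
    rw [Nat.card_Icc]
    omega
  · obtain ⟨hd, u, hu, hsent⟩ := hj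
    exact Finset.mem_image.2 ⟨p - d j, hr j _ u hu hsent, by omega⟩

theorem measure_lt_card_busy_le {Ω : Type*} [MeasurableSpace Ω] {μ : Measure Ω}
    {d : Fin ℓ → Ω → ℕ} (hd : ∀ j, Measurable (d j)) (hind : iIndepFun d μ)
    (hunif : ∀ j, μ.map (d j) = uniformOn (Set.Icc 1 ℓ)) (K : ℝ) (p : ℕ) (v : V) :
    μ {ω | K < ((F.busy G (fun j => d j ω) p v).ncard : ℝ)} ≤
      ENNReal.ofReal (Real.exp (6 - K)) := by
  obtain ⟨D, hD, hbusy⟩ := F.exists_delays_of_busy G p v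
  refine le_trans (measure_mono fun ω hω => ?_)
    (measure_lt_card_hits_le hd hind hunif D hD K)
  have hω : K < ((F.busy G (fun j => d j ω) p v).ncard : ℝ) := hω
  exact lt_of_lt_of_le hω
    (Nat.cast_le.2 (Set.ncard_le_ncard (hbusy fun j => d j ω) (Set.toFinite _)))

/-- After `ℓ` plus the number of nodes many phases nothing happens any more. -/
theorem busy_eq_empty {d : Fin ℓ → ℕ} (hd : ∀ j, d j ≤ ℓ) {p : ℕ} (hp : ℓ + Fintype.card V ≤ p)
    (v : V) : F.busy G d p v = ∅ := by
  refine Set.eq_empty_of_forall_notMem fun j hj => ?_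
  obtain ⟨-, u, -, hsent⟩ := hj
  have := hd j
  exact hsent (partialBFS.completeAfter_card _ G _ _ (by omega) u).1

/-- Except with polynomially small probability, all delays are in range and in every phase only
logarithmically many algorithms are busy around any node. -/
theorem measure_congested_le {Ω : Type*} [MeasurableSpace Ω] {μ : Measure Ω}
    {d : Fin ℓ → Ω → ℕ} (hd : ∀ j, Measurable (d j)) (hind : iIndepFun d μ)
    (hunif : ∀ j, μ.map (d j) = uniformOn (Set.Icc 1 ℓ)) {n : ℕ} (hn : 2 ≤ n)
    (hV : Fintype.card V = n) (hℓ : ℓ ≤ n) (c : ℕ) :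
    μ {ω | ¬ ((∀ j, d j ω ≤ ℓ) ∧
      ∀ p v, ((F.busy G (fun j => d j ω) p v).ncard : ℝ) ≤ (c + 12) * Real.log n)} ≤
      ENNReal.ofReal (1 / (n : ℝ) ^ c) := by
  set K : ℝ := (c + 12) * Real.log n with hK
  have hlog : 0 ≤ Real.log n := Real.log_natCast_nonneg n
  have hsub : {ω | ¬ ((∀ j, d j ω ≤ ℓ) ∧
      ∀ p v, ((F.busy G (fun j => d j ω) p v).ncard : ℝ) ≤ K)} ⊆
      (⋃ j, d j ⁻¹' (Set.Iic ℓ)ᶜ) ∪ ⋃ v ∈ (Finset.univ : Finset V), ⋃ p ∈ Finset.range (2 * n),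
        {ω | K < ((F.busy G (fun j => d j ω) p v).ncard : ℝ)} := by
    intro ω hω
    by_cases hdω : ∀ j, d j ω ≤ ℓ
    · right
      obtain ⟨p, v, hpv⟩ : ∃ p v, K < ((F.busy G (fun j => d j ω) p v).ncard : ℝ) := by
        by_contra! hcon
        exact hω ⟨hdω, hcon⟩
      have hp : p < 2 * n := by
        by_contra hp
        rw [F.busy_eq_empty G hdω (by omega) v, Set.ncard_empty, Nat.cast_zero] at hpv
        have : 0 ≤ K := by positivity
        linarith
      simp only [Set.mem_iUnion, Finset.mem_range]
      exact ⟨v, Finset.mem_univ v, p, hp, hpv⟩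
    · left
      simpa using hdω
  have hzero : μ (⋃ j, d j ⁻¹' (Set.Iic ℓ)ᶜ) = 0 := by
    refine measure_iUnion_null fun j => ?_
    rw [← Measure.map_apply (hd j) (Set.to_countable _).measurableSet, hunif j,
      uniformOn_eq_zero_iff (Set.finite_Icc 1 ℓ)]
    exact Set.eq_empty_of_forall_notMem fun x hx => hx.2 hx.1.2
  -- `2 * n * n` pairs of a node and a phase, `exp 6 ≤ 2 ^ 9 ≤ n ^ 9`, and `exp K = n ^ (c + 12)`
  have hnum : ((n * (2 * n) : ℕ) : ℝ) * Real.exp (6 - K) ≤ 1 / (n : ℝ) ^ c := by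
    have hn' : (2 : ℝ) ≤ n := by exact_mod_cast hn
    have hn0 : (0 : ℝ) < n := by linarith
    have hexpK : Real.exp K = (n : ℝ) ^ (c + 12) := by
      rw [hK, show ((c : ℝ) + 12) = ((c + 12 : ℕ) : ℝ) by push_cast; ring, Real.exp_nat_mul,
        Real.exp_log hn0]
    have h6 : Real.exp 6 ≤ (n : ℝ) ^ 9 := by
      have he : Real.exp 1 ≤ 2.72 := by linarith [Real.exp_one_lt_d9]
      calc Real.exp 6 = Real.exp 1 ^ 6 := by rw [← Real.exp_nat_mul]; norm_num
        _ ≤ 2.72 ^ 6 := pow_le_pow_left₀ (Real.exp_nonneg _) he 6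
        _ ≤ 2 ^ 9 := by norm_num
        _ ≤ (n : ℝ) ^ 9 := pow_le_pow_left₀ zero_le_two hn' 9
    rw [Real.exp_sub, hexpK, ← mul_div_assoc, div_le_div_iff₀ (by positivity) (by positivity),
      one_mul, pow_add, mul_comm _ ((n : ℝ) ^ c)]
    gcongr
    calc ((n * (2 * n) : ℕ) : ℝ) * Real.exp 6 ≤ ((n * (n * n) : ℕ) : ℝ) * (n : ℝ) ^ 9 := by gcongr
      _ = (n : ℝ) ^ 12 := by push_cast; ring
  calc μ {ω | ¬ ((∀ j, d j ω ≤ ℓ) ∧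
      ∀ p v, ((F.busy G (fun j => d j ω) p v).ncard : ℝ) ≤ K)}
      ≤ 0 + ∑ v : V, ∑ p ∈ Finset.range (2 * n),
        μ {ω | K < ((F.busy G (fun j => d j ω) p v).ncard : ℝ)} := by
        refine (measure_mono hsub).trans ((measure_union_le _ _).trans ?_)
        rw [hzero]
        gcongr
        refine (measure_biUnion_finset_le _ _).trans ?_
        gcongr
        exact measure_biUnion_finset_le _ _
    _ ≤ 0 + ∑ v : V, ∑ p ∈ Finset.range (2 * n), ENNReal.ofReal (Real.exp (6 - K)) := by
        gcongr
        exact F.measure_lt_card_busy_le G hd hind hunif K _ _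
    _ = ENNReal.ofReal (((n * (2 * n) : ℕ) : ℝ) * Real.exp (6 - K)) := by
        rw [zero_add, Finset.sum_const, Finset.sum_const, Finset.card_univ, Finset.card_range, hV,
          smul_smul, nsmul_eq_mul, ENNReal.ofReal_mul (Nat.cast_nonneg _), ENNReal.ofReal_natCast]
    _ ≤ ENNReal.ofReal (1 / (n : ℝ) ^ c) := ENNReal.ofReal_le_ofReal hnum

end BFSCollection

/-! ### Message size and conclusion -/

theorem Nat.clog_two_le_three_mul_log {n : ℕ} (hn : 2 ≤ n) :
    (Nat.clog 2 n : ℝ) ≤ 3 * Real.log n := by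
  have hlog2 := Real.log_two_gt_d9
  have hlog : Real.log 2 ≤ Real.log n :=
    Real.log_le_log two_pos (by exact_mod_cast hn)
  have hlt : (2 : ℝ) ^ (Nat.clog 2 n - 1) ≤ n := by
    exact_mod_cast (Nat.pow_pred_clog_lt_self one_lt_two (by omega : 1 < n)).le
  have h := Real.log_le_log (by positivity) hlt
  rw [Real.log_pow] at h
  have hpos : 1 ≤ Nat.clog 2 n := Nat.clog_pos one_lt_two hn
  rw [Nat.cast_sub hpos] at h
  push_cast at h
  nlinarith

/-- A tagged message is an element of `Fin ℓ × Fin N`, of which there are at most `n ^ (a + 1)`. -/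
theorem BFSScheduler.messageBits_le {n N ℓ a : ℕ} (S : BFSScheduler N ℓ) (hn : 2 ≤ n)
    (hN : N ≤ n ^ a) (hℓ : ℓ ≤ n) : (S.messageBits : ℝ) ≤ 3 * (a + 1) * Real.log n := by
  have hle : S.messageBits ≤ (a + 1) * Nat.clog 2 n := by
    rw [BCongestAlgorithm.messageBits, Nat.card_prod, Nat.card_fin, Nat.card_fin]
    refine Nat.clog_le_of_le_pow ?_
    calc ℓ * N ≤ n * n ^ a := Nat.mul_le_mul hℓ hN
      _ = n ^ (a + 1) := (pow_succ' n a).symm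
      _ ≤ (2 ^ Nat.clog 2 n) ^ (a + 1) :=
        Nat.pow_le_pow_left (Nat.le_pow_clog one_lt_two n) _
      _ = 2 ^ ((a + 1) * Nat.clog 2 n) := by rw [← pow_mul, mul_comm]
  calc (S.messageBits : ℝ) ≤ (a + 1) * Nat.clog 2 n := by exact_mod_cast hle
    _ ≤ (a + 1) * (3 * Real.log n) := by gcongr; exact Nat.clog_two_le_three_mul_log hn
    _ = 3 * (a + 1) * Real.log n := by ring

theorem mainTheorem8 :
    ∃ k : ℕ, ∀ c : ℕ, ∃ C : ℝ, 0 < C ∧ ∀ a : ℕ, ∃ B : ℝ,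
      ∀ n N ℓ : ℕ, 2 ≤ n → N ≤ n ^ a → ℓ ≤ n → ∀ h : Fin ℓ → ℕ∞,
      ∃ (L : ℕ) (S : BFSScheduler N ℓ),
        0 < L ∧ (L : ℝ) ≤ C * Real.log n ∧ (S.messageBits : ℝ) ≤ B * Real.log n ∧
        ∀ (V : Type*) [Fintype V] (G : SimpleGraph V) (F : BFSCollection V N ℓ)
          (Ω : Type*) [MeasurableSpace Ω] (μ : Measure Ω) [IsProbabilityMeasure μ]
          (d : Fin ℓ → Ω → ℕ),
          Fintype.card V = n → F.depth = h →
          (∀ j, Measurable (d j)) → iIndepFun d μ →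
          (∀ j, μ.map (d j) = uniformOn (Set.Icc 1 ℓ)) →
          μ {ω | ¬ (S.ExecutesWithDelays G F (fun j => d j ω) L ∧
              (∃ T : ℕ, (T : ℝ) ≤ C * ((ℓ : ℝ) + F.dilation G) * Real.log n ^ k ∧
                S.AllCompleteAfter G F (fun j => d j ω) T) ∧
              (∀ (t : ℕ) (v : V),
                ((S.receivedInRound G F (fun j => d j ω) t v).ncard : ℝ) ≤ C * Real.log n) ∧
              (∀ (p : ℕ) (v : V),
                ((S.receivedInPhase G F (fun j => d j ω) L p v).ncard : ℝ) ≤ C * Real.log n))}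
            ≤ ENNReal.ofReal (1 / (n : ℝ) ^ c) := by
  -- `C = c + 12` makes the union bound over nodes and phases close; a phase has `⌊C log n⌋` rounds
  refine ⟨1, fun c => ⟨c + 12, by positivity, fun a => ⟨3 * (a + 1), ?_⟩⟩⟩
  intro n N ℓ hn hN hℓ h
  have hlog : 1 / 2 ≤ Real.log n := by
    have := Real.log_two_gt_d9
    have := Real.log_le_log two_pos (by exact_mod_cast hn : (2 : ℝ) ≤ n)
    linarith
  have hK : 1 ≤ ((c : ℝ) + 12) * Real.log n := by
    nlinarith [(Nat.cast_nonneg c : (0 : ℝ) ≤ c)]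
  set L : ℕ := ⌊((c : ℝ) + 12) * Real.log n⌋₊ with hLdef
  have hL : 0 < L := Nat.floor_pos.2 hK
  have hLK : (L : ℝ) ≤ (c + 12) * Real.log n := Nat.floor_le (by linarith)
  refine ⟨L, delayedScheduler N ℓ h L, hL, hLK, BFSScheduler.messageBits_le _ hn hN hℓ, ?_⟩
  intro V _ G F Ω _ μ _ d hV hF hd hind hunif
  subst hF
  refine le_trans (measure_mono ?_) (F.measure_congested_le G hd hind hunif hn hV hℓ c)
  -- the good event of the union bound implies, deterministically, everything that is claimed
  refine Set.compl_subset_compl.2 ?_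
  rintro ω ⟨hdω, hbusy⟩
  have hq : ∀ p v, (F.queue G (fun j => d j ω) p v).length ≤ L := fun p v =>
    (F.length_queue_le G _ p v).trans (Nat.le_floor (hbusy p v))
  have hphase : ∀ p v, (((delayedScheduler N ℓ F.depth L).receivedInPhase G F
      (fun j => d j ω) L p v).ncard : ℝ) ≤ (c + 12) * Real.log n := fun p v =>
    (Nat.cast_le.2 (Set.ncard_le_ncard
      (delayedScheduler.receivedInPhase_subset hL hq p v) (Set.toFinite _))).trans (hbusy p v)
  refine ⟨delayedScheduler.executesWithDelays hL hq,
    ⟨L * (ℓ + F.dilation G), ?_, delayedScheduler.allCompleteAfter hL hq hdω⟩,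
    fun t v => le_trans ?_ (hphase (t / L) v), hphase⟩
  · calc ((L * (ℓ + F.dilation G) : ℕ) : ℝ) = L * ((ℓ : ℝ) + F.dilation G) := by push_cast; ring
      _ ≤ (c + 12) * Real.log n * ((ℓ : ℝ) + F.dilation G) := by gcongr
      _ = (c + 12) * ((ℓ : ℝ) + F.dilation G) * Real.log n ^ 1 := by ring
  · exact Nat.cast_le.2 (Set.ncard_le_ncard
      (BFSScheduler.receivedInRound_subset _ G F _ hL t v) (Set.toFinite _))
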